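/- For $n\ge 1$ let $G(n)$ be the bipartite graph with vertices $x_1,\dots,x_n,y_1,\dots,y_n$ whose edges are the pairs $x_iy_j$ with $1\le i\le j\le n$. A monotone formula is a formula built from variables using only $\vee$ and $\wedge$ (no constants, no negations). Its minterms are the inclusion-minimal sets among the sets of variables of the products that arise when the formula is expanded, by distributivity and idempotency, into a disjunction of conjunctions of distinct variables. The readability of $G(n)$ is the least $k$ for which there is a monotone formula, whose variables are the vertices of $G(n)$, such that no variable occurs more than $k$ times in it and its minterms are exactly the sets $\{x_i,y_j\}$ for the edges $x_iy_j$ of $G(n)$. Theorem. The readability of $G(n)$ is $\Omega\left(\sqrt{\frac{\log n}{\log\log n}}\right)$; that is, there are a constant $c>0$ and an integer $N$ such that for all $n\ge N$ the readability of $G(n)$ is at least $c\sqrt{\frac{\log n}{\log\log n}}$. -/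

import Mathlib

/-- Monotone Boolean formulas over the set of variables `α`, built with `∨` (`add`) and `∧`
(`mul`), without constants. Operations of larger arity are nested binary ones, which changes
neither the function nor the number of occurrences of a variable. -/
inductive MonotoneFormula (α : Type*) : Type _
  | var (a : α) : MonotoneFormula α
  | add (φ ψ : MonotoneFormula α) : MonotoneFormula α
  | mul (φ ψ : MonotoneFormula α) : MonotoneFormula α

namespace MonotoneFormula

variable {α : Type*} [DecidableEq α]

/-- The number of occurrences of the variable `a` in a formula. -/
def occurrences (a : α) : MonotoneFormula α → ℕ
  | var b => if b = a then 1 else 0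
  | add φ ψ => occurrences a φ + occurrences a ψ
  | mul φ ψ => occurrences a φ + occurrences a ψ

/-- No variable occurs more than `k` times. -/
def IsRead (k : ℕ) (φ : MonotoneFormula α) : Prop :=
  ∀ a, φ.occurrences a ≤ k

/-- The complete sum of products: the terms obtained by distributivity and idempotency.
A term, i.e. a product of distinct variables, is the set of its variables. -/
def csop : MonotoneFormula α → Finset (Finset α)
  | var a => {{a}}
  | add φ ψ => csop φ ∪ csop ψ
  | mul φ ψ => Finset.image₂ (· ∪ ·) (csop φ) (csop ψ)

/-- The sum of minterms: the terms that survive absorption, i.e. the inclusion-minimal terms of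
the complete sum of products. -/
def sop (φ : MonotoneFormula α) : Finset (Finset α) :=
  {S ∈ φ.csop | ∀ T ∈ φ.csop, ¬ T ⊂ S}

end MonotoneFormula

namespace SimpleGraph

variable {V : Type*} [DecidableEq V]

/-- `φ` is a formula for `G`: its minterms are precisely the edges of `G`. -/
def IsFormulaFor (G : SimpleGraph V) (φ : MonotoneFormula V) : Prop :=
  ∀ S : Finset V, S ∈ φ.sop ↔ ∃ u v, G.Adj u v ∧ S = {u, v}

/-- `G` is read-`k` (a notion meant for triangle-free graphs). -/
def IsRead (G : SimpleGraph V) (k : ℕ) : Prop :=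
  ∃ φ : MonotoneFormula V, G.IsFormulaFor φ ∧ φ.IsRead k

/-- The least `k` such that `G` is read-`k` (it would be `0` if there were none). -/
noncomputable def readability (G : SimpleGraph V) : ℕ :=
  sInf {k | G.IsRead k}

end SimpleGraph

/-- The bipartite chain graph on `x_i = Sum.inl i` and `y_j = Sum.inr j`, with the edges
`x_i y_j` for `i ≤ j`. -/
def chainGraph (n : ℕ) : SimpleGraph (Fin n ⊕ Fin n) :=
  SimpleGraph.fromRel fun u v => ∃ i j : Fin n, i ≤ j ∧ u = Sum.inl i ∧ v = Sum.inr j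

/-! Let `φ` have at most `k` occurrences of each `x i` and at most `b` of each `y j`. For the least
index, `x` pairs with every `y j`: `φ` is true at `{x, y j}` but false at `{x}` and at `{y j}`.
Following `φ` down to the occurrences of `x`, one finds for each occurrence a group of indices `j`
for which some subformula, false at `∅`, is true at every `{y j}` (`card_le_occ_mul`). Replacing
that subformula by `true` changes no value on sets containing some `y j` of the group, and removes
an occurrence of each such `y j`. Without its least index, the group satisfies the same hypotheses
with `b - 1`. Induction on `b` gives fewer than `(k + 1) ^ b` indices, so `n < (k + 1) ^ k` for a
read-`k` formula. -/

/-- Monotone formulas with an additional constant `true`. -/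
inductive TopFormula (α : Type*) : Type _
  | tru : TopFormula α
  | var (a : α) : TopFormula α
  | add (φ ψ : TopFormula α) : TopFormula α
  | mul (φ ψ : TopFormula α) : TopFormula α

/-! ### Formulas with `true`, reductions and the counting argument. -/

namespace TopFormula

variable {α ι : Type*}

/-- The value of a formula when precisely the variables in `S` are true. -/
def Eval (S : Set α) : TopFormula α → Prop
  | tru => True
  | var a => a ∈ S
  | add φ ψ => Eval S φ ∨ Eval S ψ
  | mul φ ψ => Eval S φ ∧ Eval S ψ

theorem Eval.mono {S T : Set α} (h : S ⊆ T) {φ : TopFormula α} (hφ : φ.Eval S) : φ.Eval T := by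
  induction φ with
  | tru => trivial
  | var a => exact h hφ
  | add φ ψ ih₁ ih₂ => exact hφ.imp ih₁ ih₂
  | mul φ ψ ih₁ ih₂ => exact hφ.imp ih₁ ih₂

variable [DecidableEq α]

/-- The number of occurrences of the variable `a` in a formula. -/
def occ (a : α) : TopFormula α → ℕ
  | tru => 0
  | var b => if b = a then 1 else 0
  | add φ ψ => occ a φ + occ a ψ
  | mul φ ψ => occ a φ + occ a ψ

theorem Eval.of_insert {a : α} {S : Set α} {φ : TopFormula α} (h : φ.occ a = 0)
    (hφ : φ.Eval (insert a S)) : φ.Eval S := by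
  induction φ with
  | tru => trivial
  | var b =>
    have hb : b ≠ a := by simpa [occ] using h
    exact (Set.mem_insert_iff.1 hφ).resolve_left hb
  | add φ ψ ih₁ ih₂ =>
    simp only [occ, Nat.add_eq_zero_iff] at h
    exact hφ.imp (ih₁ h.1) (ih₂ h.2)
  | mul φ ψ ih₁ ih₂ =>
    simp only [occ, Nat.add_eq_zero_iff] at h
    exact hφ.imp (ih₁ h.1) (ih₂ h.2)

theorem occ_pos_of_eval_singleton {a : α} {φ : TopFormula α} (h : φ.Eval {a})
    (h' : ¬ φ.Eval ∅) : 0 < φ.occ a :=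
  Nat.pos_of_ne_zero fun h0 => h' (Eval.of_insert (a := a) h0 (by simpa using h))

/-- `φ'` agrees with `φ` on all sets that contain some `y j` with `j ∈ J`, has no more occurrences
of any variable, and has fewer occurrences of every `y j` with `j ∈ J`. -/
structure Reduces (y : ι → α) (J : Finset ι) (φ φ' : TopFormula α) : Prop where
  eval_iff : ∀ j ∈ J, ∀ S : Set α, y j ∈ S → (φ'.Eval S ↔ φ.Eval S)
  occ_lt : ∀ j ∈ J, φ'.occ (y j) < φ.occ (y j)
  occ_le : ∀ a, φ'.occ a ≤ φ.occ a

namespace Reduces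

variable {y : ι → α} {J : Finset ι} {φ φ' : TopFormula α}

/-- By monotonicity `φ` is already true on every set containing some `y j`; being false at `∅`, it
must contain each of these `y j`. -/
theorem tru_of_eval (h0 : ¬ φ.Eval ∅) (hJ : ∀ j ∈ J, φ.Eval {y j}) : Reduces y J φ tru where
  eval_iff j hj _ hS :=
    iff_of_true trivial ((hJ j hj).mono (Set.singleton_subset_iff.2 hS))
  occ_lt j hj := occ_pos_of_eval_singleton (hJ j hj) h0
  occ_le _ := Nat.zero_le _

theorem add_right (h : Reduces y J φ φ') (ψ : TopFormula α) :
    Reduces y J (add φ ψ) (add φ' ψ) where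
  eval_iff j hj S hS := or_congr_left (h.eval_iff j hj S hS)
  occ_lt j hj := Nat.add_lt_add_right (h.occ_lt j hj) _
  occ_le a := Nat.add_le_add_right (h.occ_le a) _

theorem add_left (h : Reduces y J φ φ') (ψ : TopFormula α) :
    Reduces y J (add ψ φ) (add ψ φ') where
  eval_iff j hj S hS := or_congr_right (h.eval_iff j hj S hS)
  occ_lt j hj := Nat.add_lt_add_left (h.occ_lt j hj) _
  occ_le a := Nat.add_le_add_left (h.occ_le a) _

theorem mul_right (h : Reduces y J φ φ') (ψ : TopFormula α) :
    Reduces y J (mul φ ψ) (mul φ' ψ) where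
  eval_iff j hj S hS := and_congr_left' (h.eval_iff j hj S hS)
  occ_lt j hj := Nat.add_lt_add_right (h.occ_lt j hj) _
  occ_le a := Nat.add_le_add_right (h.occ_le a) _

theorem mul_left (h : Reduces y J φ φ') (ψ : TopFormula α) :
    Reduces y J (mul ψ φ) (mul ψ φ') where
  eval_iff j hj S hS := and_congr_right' (h.eval_iff j hj S hS)
  occ_lt j hj := Nat.add_lt_add_left (h.occ_lt j hj) _
  occ_le a := Nat.add_le_add_left (h.occ_le a) _

end Reduces

/-- The conjunction step of `card_le_occ_mul`, for the factor `φ` that is false at `{x}`. -/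
theorem card_le_occ_mul_of_not_eval_left {y : ι → α} {I Y : Finset ι} {x : α} {M : ℕ}
    {φ ψ : TopFormula α} (hYI : Y ⊆ I) (hx : ¬ φ.Eval {x})
    (hY : ∀ j ∈ Y, (mul φ ψ).Eval {x, y j} ∧ ¬ (mul φ ψ).Eval {y j})
    (hφ : ∀ J ⊆ I, ∀ φ', Reduces y J φ φ' → J.card ≤ M)
    (ih : ∀ Z ⊆ I, (∀ j ∈ Z, φ.Eval {x, y j} ∧ ¬ φ.Eval {y j}) → Z.card ≤ φ.occ x * M) :
    Y.card ≤ (mul φ ψ).occ x * M := by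
  classical
  have hφ0 : ¬ φ.Eval ∅ := fun h => hx (h.mono (Set.empty_subset _))
  have h₁ : (Y.filter fun j => φ.Eval {y j}).card ≤ M :=
    hφ _ ((Finset.filter_subset _ _).trans hYI) _
      (Reduces.tru_of_eval hφ0 fun j hj => (Finset.mem_filter.1 hj).2)
  have h₂ : (Y.filter fun j => ¬ φ.Eval {y j}).card ≤ φ.occ x * M := by
    refine ih _ ((Finset.filter_subset _ _).trans hYI) fun j hj => ?_
    obtain ⟨hj, hj'⟩ := Finset.mem_filter.1 hj
    exact ⟨(hY j hj).1.1, hj'⟩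
  have hsum := Finset.card_filter_add_card_filter_not (s := Y) fun j => φ.Eval {y j}
  change Y.card ≤ (φ.occ x + ψ.occ x) * M
  rw [add_mul]
  -- An occurrence of `x` in `ψ` pays for the extra `M`. Without one, `ψ` is true at every `{y j}`,
  -- so `φ` is false there and the first class is empty.
  rcases Nat.eq_zero_or_pos (ψ.occ x) with hψx | hψx
  · have hψy : ∀ j ∈ Y, ψ.Eval {y j} := fun j hj => Eval.of_insert hψx (hY j hj).1.2
    have h0 : (Y.filter fun j => φ.Eval {y j}).card = 0 := by
      rw [Finset.card_eq_zero, Finset.filter_eq_empty_iff]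
      exact fun j hj h => (hY j hj).2 ⟨h, hψy j hj⟩
    omega
  · have := Nat.le_mul_of_pos_left M hψx
    omega

/-- If `{x}` and all `{y j}` falsify `φ`, but all `{x, y j}` satisfy it, and no reduction of `φ`
concerns more than `M` of the `y j`, then there are at most `M` of them for each occurrence
of `x`. -/
theorem card_le_occ_mul {y : ι → α} {I : Finset ι} {x : α} {M : ℕ} (φ : TopFormula α) :
    ∀ Y ⊆ I, ¬ φ.Eval {x} → (∀ j ∈ Y, φ.Eval {x, y j} ∧ ¬ φ.Eval {y j}) →
      (∀ J ⊆ I, ∀ φ', Reduces y J φ φ' → J.card ≤ M) → Y.card ≤ φ.occ x * M := by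
  classical
  induction φ with
  | tru => exact fun Y _ hx => absurd trivial hx
  | var a =>
    intro Y _ hx hY _
    have : Y = ∅ := by
      refine Finset.eq_empty_of_forall_notMem fun j hj => ?_
      obtain ⟨h | h, h'⟩ := hY j hj
      · exact hx h
      · exact h' h
    simp [this]
  | add φ ψ ih₁ ih₂ =>
    intro Y hYI hx hY hM
    have hx' := not_or.1 hx
    have h₁ : (Y.filter fun j => φ.Eval {x, y j}).card ≤ φ.occ x * M := by
      refine ih₁ _ ((Finset.filter_subset _ _).trans hYI) hx'.1 (fun j hj => ?_)
        fun J hJ φ' h => hM J hJ _ (h.add_right ψ)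
      obtain ⟨hj, hj'⟩ := Finset.mem_filter.1 hj
      exact ⟨hj', (not_or.1 (hY j hj).2).1⟩
    have h₂ : (Y.filter fun j => ¬ φ.Eval {x, y j}).card ≤ ψ.occ x * M := by
      refine ih₂ _ ((Finset.filter_subset _ _).trans hYI) hx'.2 (fun j hj => ?_)
        fun J hJ φ' h => hM J hJ _ (h.add_left φ)
      obtain ⟨hj, hj'⟩ := Finset.mem_filter.1 hj
      exact ⟨(hY j hj).1.resolve_left hj', (not_or.1 (hY j hj).2).2⟩
    have hsum := Finset.card_filter_add_card_filter_not (s := Y) fun j => φ.Eval {x, y j}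
    change Y.card ≤ (φ.occ x + ψ.occ x) * M
    rw [add_mul]
    omega
  | mul φ ψ ih₁ ih₂ =>
    intro Y hYI hx hY hM
    have hφ : ∀ J ⊆ I, ∀ φ', Reduces y J φ φ' → J.card ≤ M :=
      fun J hJ φ' h => hM J hJ _ (h.mul_right ψ)
    have hψ : ∀ J ⊆ I, ∀ ψ', Reduces y J ψ ψ' → J.card ≤ M :=
      fun J hJ ψ' h => hM J hJ _ (h.mul_left φ)
    by_cases hx₁ : φ.Eval {x}
    · have hx₂ : ¬ ψ.Eval {x} := fun h => hx ⟨hx₁, h⟩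
      have := card_le_occ_mul_of_not_eval_left (ψ := φ) hYI hx₂
        (fun j hj => ⟨(hY j hj).1.symm, fun h => (hY j hj).2 h.symm⟩) hψ
        fun Z hZ hZ' => ih₂ Z hZ hx₂ hZ' hψ
      rwa [occ, add_comm] at this
    · exact card_le_occ_mul_of_not_eval_left hYI hx₁ hY hφ
        fun Z hZ hZ' => ih₁ Z hZ hx₁ hZ' hφ

/-- A formula that decides `i ≤ j` on the pairs `{x i, y j}` and is false on singletons, with at
most `k` occurrences of each `x i` and at most `b` of each `y j`, has fewer than `(k + 1) ^ b`
indices. -/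
theorem card_lt_pow_of_eval_iff_le [LinearOrder ι] {x y : ι → α} {k b : ℕ} (φ : TopFormula α)
    (I : Finset ι) (hx : ∀ i ∈ I, ¬ φ.Eval {x i}) (hy : ∀ j ∈ I, ¬ φ.Eval {y j})
    (hxy : ∀ i ∈ I, ∀ j ∈ I, (φ.Eval {x i, y j} ↔ i ≤ j))
    (hk : ∀ i ∈ I, φ.occ (x i) ≤ k) (hb : ∀ j ∈ I, φ.occ (y j) ≤ b) :
    I.card < (k + 1) ^ b := by
  induction b generalizing φ I with
  | zero =>
    have : I = ∅ := by
      refine Finset.eq_empty_of_forall_notMem fun i hi => hx i hi ?_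
      refine Eval.of_insert (a := y i) (Nat.le_zero.1 (hb i hi)) ?_
      rw [Set.pair_comm]
      exact (hxy i hi i hi).2 le_rfl
    simp [this]
  | succ b ih =>
    rcases I.eq_empty_or_nonempty with rfl | hI
    · simp
    have hmin := I.min'_mem hI
    have hM : ∀ J ⊆ I, ∀ φ', Reduces y J φ φ' → J.card ≤ (k + 1) ^ b := by
      intro J hJI φ' h
      rcases J.eq_empty_or_nonempty with rfl | hJ
      · simp
      have hm := J.min'_mem hJ
      set m := J.min' hJ
      have hsub : ∀ i ∈ J.erase m, i ∈ I := fun i hi => hJI (Finset.mem_of_mem_erase hi)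
      have hev : ∀ i ∈ I, ∀ j ∈ J, (φ'.Eval {x i, y j} ↔ i ≤ j) := fun i hi j hj =>
        (h.eval_iff j hj _ (by simp)).trans (hxy i hi j (hJI hj))
      -- If `φ'` is true at `{x i}`, it is true at `{x i, y m}`, so `i ≤ m`; hence only `i = m` has
      -- to be dropped from `J`. The strict bound of the induction hypothesis makes up for this
      -- index.
      have := ih φ' (J.erase m)
        (fun i hi hφ => by
          have hle : i ≤ m := (hev i (hsub i hi) m hm).1 (hφ.mono (by simp))
          exact Finset.ne_of_mem_erase hi
            (le_antisymm hle (J.min'_le i (Finset.mem_of_mem_erase hi))))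
        (fun j hj hφ => hy j (hsub j hj)
          ((h.eval_iff j (Finset.mem_of_mem_erase hj) _ (Set.mem_singleton _)).1 hφ))
        (fun i hi j hj => hev i (hsub i hi) j (Finset.mem_of_mem_erase hj))
        (fun i hi => (h.occ_le _).trans (hk i (hsub i hi)))
        (fun j hj => Nat.le_of_lt_succ
          ((h.occ_lt j (Finset.mem_of_mem_erase hj)).trans_le (hb j (hsub j hj))))
      rw [Finset.card_erase_of_mem hm] at this
      omega
    have h := card_le_occ_mul (y := y) φ I subset_rfl (hx _ hmin)
      (fun j hj => ⟨(hxy _ hmin j hj).2 (I.min'_le j hj), hy j hj⟩) hM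
    have h' := h.trans (Nat.mul_le_mul_right _ (hk _ hmin))
    have hpos : 0 < (k + 1) ^ b := by positivity
    calc I.card ≤ k * (k + 1) ^ b := h'
      _ < (k + 1) ^ (b + 1) := by rw [pow_succ]; nlinarith

end TopFormula

/-! ### From minterms to truth values. -/

namespace MonotoneFormula

variable {α : Type*} [DecidableEq α]

/-- A monotone formula as a formula with constant `true`. -/
def toTop : MonotoneFormula α → TopFormula α
  | var a => .var a
  | add φ ψ => .add φ.toTop ψ.toTop
  | mul φ ψ => .mul φ.toTop ψ.toTop

theorem occ_toTop (a : α) (φ : MonotoneFormula α) : φ.toTop.occ a = φ.occurrences a := by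
  induction φ with
  | var b => rfl
  | add φ ψ ih₁ ih₂ => simp [toTop, TopFormula.occ, occurrences, ih₁, ih₂]
  | mul φ ψ ih₁ ih₂ => simp [toTop, TopFormula.occ, occurrences, ih₁, ih₂]

theorem eval_toTop_iff_csop (S : Set α) (φ : MonotoneFormula α) :
    φ.toTop.Eval S ↔ ∃ T ∈ φ.csop, (T : Set α) ⊆ S := by
  induction φ with
  | var b => simp [toTop, TopFormula.Eval, csop]
  | add φ ψ ih₁ ih₂ =>
    simp only [toTop, TopFormula.Eval, ih₁, ih₂, csop, Finset.mem_union, or_and_right, exists_or]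
  | mul φ ψ ih₁ ih₂ =>
    simp only [toTop, TopFormula.Eval, ih₁, ih₂, csop, Finset.mem_image₂]
    constructor
    · rintro ⟨⟨T, hT, hTS⟩, U, hU, hUS⟩
      exact ⟨_, ⟨T, hT, U, hU, rfl⟩, by simp [hTS, hUS]⟩
    · rintro ⟨_, ⟨T, hT, U, hU, rfl⟩, h⟩
      rw [Finset.coe_union, Set.union_subset_iff] at h
      exact ⟨⟨T, hT, h.1⟩, U, hU, h.2⟩

theorem mem_sop {φ : MonotoneFormula α} {S : Finset α} :
    S ∈ φ.sop ↔ S ∈ φ.csop ∧ ∀ T ∈ φ.csop, ¬ T ⊂ S :=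
  Finset.mem_filter

theorem eval_toTop_iff_sop (S : Set α) (φ : MonotoneFormula α) :
    φ.toTop.Eval S ↔ ∃ T ∈ φ.sop, (T : Set α) ⊆ S := by
  rw [eval_toTop_iff_csop]
  constructor
  · rintro ⟨T, hT, hTS⟩
    obtain ⟨U, hUT, hU⟩ := φ.csop.finite_toSet.exists_le_minimal hT
    refine ⟨U, mem_sop.2 ⟨hU.1, fun W hW hlt => hU.not_lt hW hlt⟩, ?_⟩
    exact (Finset.coe_subset.2 hUT).trans hTS
  · rintro ⟨T, hT, hTS⟩
    exact ⟨T, (mem_sop.1 hT).1, hTS⟩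

end MonotoneFormula

namespace SimpleGraph

variable {V : Type*} [DecidableEq V]

theorem IsFormulaFor.eval_iff {G : SimpleGraph V} {φ : MonotoneFormula V}
    (h : G.IsFormulaFor φ) (S : Set V) :
    φ.toTop.Eval S ↔ ∃ u ∈ S, ∃ v ∈ S, G.Adj u v := by
  rw [MonotoneFormula.eval_toTop_iff_sop]
  constructor
  · rintro ⟨T, hT, hTS⟩
    obtain ⟨u, v, huv, rfl⟩ := (h T).1 hT
    exact ⟨u, hTS (by simp), v, hTS (by simp), huv⟩
  · rintro ⟨u, hu, v, hv, huv⟩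
    exact ⟨{u, v}, (h _).2 ⟨u, v, huv, rfl⟩, by simp [Set.insert_subset_iff, hu, hv]⟩

theorem exists_csop_eq_image {E : Finset (V × V)} (hE : E.Nonempty) :
    ∃ φ : MonotoneFormula V, φ.csop = E.image fun e => {e.1, e.2} := by
  induction hE using Finset.Nonempty.cons_induction with
  | singleton e => exact ⟨.mul (.var e.1) (.var e.2), by
      simp [MonotoneFormula.csop, Finset.pair_comm]⟩
  | cons e E _ _ ih =>
    obtain ⟨φ, hφ⟩ := ih
    refine ⟨.add (.mul (.var e.1) (.var e.2)) φ, ?_⟩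
    simp only [MonotoneFormula.csop, hφ, Finset.cons_eq_insert, Finset.image_insert]
    rw [Finset.image₂_singleton, Finset.singleton_union, Finset.singleton_union]

/-- The disjunction of all edges works: its terms all have two elements, so none absorbs another.
Hence `readability` is attained and is not the default value `sInf ∅ = 0`. -/
theorem exists_isRead [Finite V] (G : SimpleGraph V) {u v : V} (huv : G.Adj u v) :
    ∃ k, G.IsRead k := by
  have := Fintype.ofFinite V
  have := Classical.decRel G.Adj
  obtain ⟨φ, hφ⟩ := exists_csop_eq_image (E := Finset.univ.filter fun e : V × V => G.Adj e.1 e.2)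
    ⟨(u, v), by simpa using huv⟩
  have hmem : ∀ S, S ∈ φ.csop ↔ ∃ u v, G.Adj u v ∧ S = {u, v} := by
    intro S
    simp [hφ, eq_comm]
  refine ⟨Finset.univ.sup fun a => φ.occurrences a, φ, fun S => ?_, fun a =>
    Finset.le_sup (f := fun a => φ.occurrences a) (Finset.mem_univ a)⟩
  rw [MonotoneFormula.mem_sop, ← hmem, and_iff_left_iff_imp]
  intro hS T hT hlt
  obtain ⟨a, b, hab, rfl⟩ := (hmem S).1 hS
  obtain ⟨c, d, hcd, rfl⟩ := (hmem T).1 hT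
  have := Finset.card_lt_card hlt
  rw [Finset.card_pair hab.ne, Finset.card_pair hcd.ne] at this
  exact lt_irrefl _ this

end SimpleGraph

/-! ### The bound for chain graphs. -/

theorem chainGraph_adj_inl_inr {n : ℕ} {i j : Fin n} :
    (chainGraph n).Adj (Sum.inl i) (Sum.inr j) ↔ i ≤ j := by
  simp [chainGraph, SimpleGraph.fromRel_adj]

theorem lt_pow_of_chainGraph_isRead {n k : ℕ} (h : (chainGraph n).IsRead k) :
    n < (k + 1) ^ k := by
  obtain ⟨φ, hφ, hk⟩ := h
  have := TopFormula.card_lt_pow_of_eval_iff_le (x := Sum.inl) (y := Sum.inr) (k := k) (b := k)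
    φ.toTop (Finset.univ : Finset (Fin n))
    (fun i _ => by simp [hφ.eval_iff]) (fun i _ => by simp [hφ.eval_iff])
    (fun i _ j _ => by
      simp [hφ.eval_iff, chainGraph_adj_inl_inr,
        (chainGraph n).adj_comm (Sum.inr j) (Sum.inl i)])
    (fun i _ => by rw [MonotoneFormula.occ_toTop]; exact hk _)
    (fun i _ => by rw [MonotoneFormula.occ_toTop]; exact hk _)
  simpa using this

theorem lt_pow_readability_chainGraph {n : ℕ} (hn : 0 < n) :
    n < ((chainGraph n).readability + 1) ^ (chainGraph n).readability := by
  refine lt_pow_of_chainGraph_isRead (Nat.sInf_mem (s := {k | (chainGraph n).IsRead k}) ?_)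
  exact (chainGraph n).exists_isRead (chainGraph_adj_inl_inr.2 (le_refl (⟨0, hn⟩ : Fin n)))

theorem theorem1 :
    ∃ c : ℝ, 0 < c ∧ ∃ N : ℕ, ∀ n : ℕ, N ≤ n →
      c * √(Real.log n / Real.log (Real.log n)) ≤ ((chainGraph n).readability : ℝ) := by
  -- This threshold ensures `log (log n) ≥ 1`, so dividing by it only decreases `log n`.
  obtain ⟨N, hN⟩ := exists_nat_ge (Real.exp (Real.exp 1))
  refine ⟨1, one_pos, N, fun n hn => ?_⟩
  have hexp : Real.exp (Real.exp 1) ≤ n := hN.trans (by exact_mod_cast hn)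
  have hn0 : (0 : ℝ) < n := (Real.exp_pos _).trans_le hexp
  have hlog : Real.exp 1 ≤ Real.log n := (Real.le_log_iff_exp_le hn0).2 hexp
  have hlog0 : 0 < Real.log n := (Real.exp_pos _).trans_le hlog
  have hloglog : 1 ≤ Real.log (Real.log n) := (Real.le_log_iff_exp_le hlog0).2 hlog
  have hlt := lt_pow_readability_chainGraph (n := n) (by exact_mod_cast hn0)
  set k := (chainGraph n).readability
  have hle : (n : ℝ) ≤ ((k : ℝ) + 1) ^ k := by exact_mod_cast hlt.le
  -- The crude estimate `log (k + 1) ≤ k` suffices in `log n ≤ k * log (k + 1)`.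
  have hk : Real.log n ≤ (k : ℝ) ^ 2 := by
    have h₁ := Real.log_le_log hn0 hle
    have h₂ : Real.log ((k : ℝ) + 1) ≤ k := by
      have := Real.log_le_sub_one_of_pos (show (0 : ℝ) < (k : ℝ) + 1 by positivity)
      linarith
    rw [Real.log_pow] at h₁
    nlinarith [mul_le_mul_of_nonneg_left h₂ (Nat.cast_nonneg (α := ℝ) k)]
  rw [one_mul]
  exact Real.sqrt_le_iff.2 ⟨Nat.cast_nonneg k, (div_le_self hlog0.le hloglog).trans hk⟩
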